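/- **Definitions.** A *pre quantum Turing machine* $M=\langle\Sigma,Q,Q_s,Q_t,\delta_0,q_i,q_f\rangle$ has a finite alphabet $\Sigma$ containing the blank $\Box$ and a symbol $1\neq\Box$, a finite set $Q$ of states, source states $Q_s\ni q_i$, target states $Q_t\ni q_f$, and a transition function $\delta_0:(Q\setminus Q_t)\times\Sigma\to\ell^2((Q\setminus Q_s)\times\Sigma\times\{L,R\})$. A *configuration* is $\langle\alpha,q,\beta,m\rangle$ with $\alpha,\beta\in\Sigma^*$ (up to blanks added to the left of $\alpha$ and to the right of $\beta$; the head reads the first symbol of $\beta$), $q\in Q$, and a counter $m\in\mathbb N$ with $m=0$ if $q\notin Q_s\cup Q_t$. It is *initial* if $q=q_i$ and *final* if $q=q_f$; $\mathrm{val}[C]$ is the number of symbols $1$ in $\alpha\beta$. Let $\mathfrak C$ be the set of configurations, with basis vectors $|C\rangle$ of $\ell^2(\mathfrak C)$. The time evolution operator $U$ is the continuous linear extension of $W=W_0+W_s+W_t$, where $W_0|C\rangle=\sum_{p,v,d}\delta_0(q,u)(p,v,d)|C_{p,v,d}\rangle$ if $C$ has counter $0$ and state $q\notin Q_t$ and reads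 $u$ (here $C_{p,v,d}$ is obtained from $C$ by writing $v$, moving the head in direction $d$ and entering state $p$, with counter $0$); $W_s$ decreases the counter of source configurations with counter $\neq 0$ by $1$; $W_t$ increases the counter of target configurations by $1$; and each of the three is $0$ on the other basis vectors. $M$ is a *quantum Turing machine* (QTM) if $U$ is unitary. For $|\phi\rangle=\sum_C e_C|C\rangle$ put $P_{|\phi\rangle}(n)=\sum_{C\text{ final},\,\mathrm{val}[C]=n}|e_C|^2$ and $|\phi_{nf}\rangle=\sum_{C\text{ not final}}e_C|C\rangle$. An *output observation* of $|\phi\rangle$ either observes a final $C$ with $e_C\ne0$, with output $\mathrm{val}[C]$, collapsed vector $\frac{e_C}{|e_C|}|C\rangle$ and probability $|e_C|^2$; or, if $|\phi_{nf}\rangle\neq0$, has output $\bot$, collapsed vector $|\phi_{nf}\rangle/\|\phi_{nf}\|$ and probability $\|\phi_{nf}\|^2$. Let $\tau:\mathbb N\to\mathbb N$ be strictly increasing. A *$\tau$-observed run* on $|\phi\rangle$ is a sequence $R=(|\psi_h\rangle)_{h\in\mathbb N}$ with $|\psi_0\rangle=|\phi\rangle$ such that $|\psi_{h+1}\rangle$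 is the collapsed vector of an output observation of $U|\psi_h\rangle$, with output $x_i$, if $h=\tau(i)$, and $|\psi_{h+1}\rangle=U|\psi_h\rangle$ if $h\notin\tau(\mathbb N)$. Its finite prefix $R[k]=(|\psi_h\rangle)_{h\le k}$ is a finite $\tau$-observed run of length $k$, whose probability $\Pr R[k]$ is the product of the probabilities of its observations; $\Pr R=\lim_k\Pr R[k]$. The output of $R[\tau(i)+1]$ is $x_i$; the output of $R$ is $n\in\mathbb N$ if $x_i=n$ for some $i$, and $\bot$ if there is no such $n$. The probability of a set of runs (or of finite runs of a given length) is the sum of the probabilities of its elements. **Theorem.** Let $M$ be a QTM, $|\phi\rangle\in\ell^2(\mathfrak C)$ a unit vector supported on initial configurations, $|\phi_k\rangle=U^k|\phi\rangle$, and $\tau:\mathbb N\to\mathbb N$ strictly increasing. For every $n\in\mathbb N$: 1. for every $i\in\mathbb N$ and $k=\tau(i)+1$, the probability of the set of finite $\tau$-observed runs of length $k$ on $|\phi\rangle$ with output $n$ equals $P_{|\phi_k\rangle}(n)$; 2. the computed output $P(n)=\lim_{k\to\infty}P_{|\phi_k\rangle}(n)$ exists, and the probability of the set of $\tau$-observed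 runs on $|\phi\rangle$ with output $n$ equals $P(n)$. -/

import Mathlib

open Filter Topology
open scoped ENNReal lp

/-- A pre Quantum Turing Machine over a finite set `Q` of states and a finite tape alphabet `S`.
The blank symbol is `default : S`; the alphabet also contains a symbol `one`, different from the
blank. The transition function gives, for a non-target state and a symbol read, a vector of
complex amplitudes indexed by (non-source state, symbol written, direction of the head). -/
structure PreQTM (Q S : Type*) [Fintype Q] [Fintype S] [Inhabited S] where
  one : S
  one_ne_blank : one ≠ default
  source : Set Q
  target : Set Q
  init : Q
  init_mem : init ∈ source
  final : Q
  final_mem : final ∈ target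
  δ : {q : Q // q ∉ target} → S → {p : Q // p ∉ source} → S → Turing.Dir → ℂ

namespace PreQTM

variable {Q S : Type*} [Fintype Q] [Fintype S] [Inhabited S]

/-- Configurations `⟨α, q, β, n⟩`. The pair of strings `(α, β)`, taken up to blanks added to the
left of `α` and to the right of `β`, is a `Turing.Tape`: the head reads the first symbol of `β`
(the blank if `β` is empty), `left` is `α` read from the head outwards, `right` is the rest
of `β`. The counter is `0` outside source and target states. -/
@[ext]
structure Conf (M : PreQTM Q S) where
  tape : Turing.Tape S
  state : Q
  counter : ℕ
  counter_eq_zero : state ∉ M.source → state ∉ M.target → counter = 0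

variable (M : PreQTM Q S)

/-- The Hilbert space of (not necessarily normalised) superpositions of configurations. -/
abbrev Space : Type _ := ℓ²(M.Conf, ℂ)

variable {M}

/-- A configuration is initial if its state is the initial state. -/
def Conf.IsInitial (C : M.Conf) : Prop := C.state = M.init

/-- A configuration is final if its state is the final state. -/
def Conf.IsFinal (C : M.Conf) : Prop := C.state = M.final

/-- The number of cells of the tape that contain the symbol `one`, i.e. the number of
occurrences of `one` in `αβ`. -/
noncomputable def Conf.val (C : M.Conf) : ℕ := {i : ℤ | C.tape.nth i = M.one}.ncard

/-- The configuration `C_{p,v,d}`: write `v` on the current cell, move the head in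
direction `d`, enter state `p`, with the counter at `0`. -/
def Conf.next (C : M.Conf) (p : Q) (v : S) (d : Turing.Dir) : M.Conf where
  tape := (C.tape.write v).move d
  state := p
  counter := 0
  counter_eq_zero := fun _ _ => rfl

/-- The source configuration obtained by decreasing the counter by `1`. -/
def Conf.dec (C : M.Conf) (h : C.state ∈ M.source) : M.Conf where
  tape := C.tape
  state := C.state
  counter := C.counter - 1
  counter_eq_zero := fun h' _ => absurd h h'

/-- The target configuration obtained by increasing the counter by `1`. -/
def Conf.inc (C : M.Conf) (h : C.state ∈ M.target) : M.Conf where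
  tape := C.tape
  state := C.state
  counter := C.counter + 1
  counter_eq_zero := fun _ h' => absurd h h'

open Classical in
/-- The base vector `|C⟩`. -/
noncomputable def ket (C : M.Conf) : M.Space := lp.single 2 C (1 : ℂ)

open Classical in
/-- Value on `|C⟩` of the part of the evolution acting on the configurations with counter `0`
and non-target state (and equal to `0` on the other base vectors). -/
noncomputable def W₀ (C : M.Conf) : M.Space :=
  if h : C.counter = 0 ∧ C.state ∉ M.target then
    ∑ p : {p : Q // p ∉ M.source}, ∑ v : S,
      (M.δ ⟨C.state, h.2⟩ C.tape.head p v Turing.Dir.left • ket (C.next p v Turing.Dir.left) +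
        M.δ ⟨C.state, h.2⟩ C.tape.head p v Turing.Dir.right • ket (C.next p v Turing.Dir.right))
  else 0

open Classical in
/-- Value on `|C⟩` of the part of the evolution acting on the source configurations with
counter different from `0`. -/
noncomputable def Wₛ (C : M.Conf) : M.Space :=
  if h : C.state ∈ M.source ∧ C.counter ≠ 0 then ket (C.dec h.1) else 0

open Classical in
/-- Value on `|C⟩` of the part of the evolution acting on the target configurations. -/
noncomputable def Wₜ (C : M.Conf) : M.Space :=
  if h : C.state ∈ M.target then ket (C.inc h) else 0

variable (M)

/-- The embedding in the Hilbert space of the finite linear combinations of base vectors. -/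
noncomputable def spanKet : (M.Conf →₀ ℂ) →ₗ[ℂ] M.Space :=
  Finsupp.linearCombination ℂ (ket (M := M))

/-- The evolution `W = W₀ + Wₛ + Wₜ` on the finite linear combinations of base vectors. -/
noncomputable def W : (M.Conf →₀ ℂ) →ₗ[ℂ] M.Space :=
  Finsupp.linearCombination ℂ (fun C : M.Conf => W₀ C + Wₛ C + Wₜ C)

/-- The time evolution operator: the unique continuous linear extension of `W` to the whole
Hilbert space. -/
noncomputable def U : M.Space →L[ℂ] M.Space := M.W.extendOfNorm M.spanKet

/-- A pre Quantum Turing Machine is a Quantum Turing Machine if its time evolution operator is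
unitary. -/
def IsQTM : Prop := M.U ∈ unitary (M.Space →L[ℂ] M.Space)

variable {M}

/-- The base vectors span a dense subspace. -/
theorem denseRange_spanKet : DenseRange M.spanKet := by
  classical
  intro φ
  have h := lp.hasSum_single (E := fun _ : M.Conf => ℂ) (p := 2) (by simp) φ
  refine mem_closure_of_tendsto h (Eventually.of_forall fun s => ?_)
  refine ⟨∑ C ∈ s, Finsupp.single C (φ C), ?_⟩
  rw [map_sum]
  refine Finset.sum_congr rfl fun C _ => ?_
  rw [spanKet, Finsupp.linearCombination_single, ket, ← lp.single_smul]
  simp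

/-- The time evolution operator of a Quantum Turing Machine has the prescribed values on the
computational basis. -/
theorem IsQTM.U_ket (hM : M.IsQTM) (C : M.Conf) : M.U (ket C) = W₀ C + Wₛ C + Wₜ C := by
  classical
  have hb : ∃ K, ∀ x, ‖M.W x‖ ≤ K * ‖M.spanKet x‖ := by
    by_contra hb
    have h0 : M.U = 0 := by
      have hz : M.W.compLeftInverse M.spanKet = 0 := by
        simp only [LinearMap.compLeftInverse]
        rw [dif_neg hb]
      rw [U, LinearMap.extendOfNorm, hz, ContinuousLinearMap.extend_zero]
      · simpa using! denseRange_spanKet (M := M)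
      · exact isUniformEmbedding_subtype_val.isUniformInducing
    have h1 := hM.1
    rw [h0, mul_zero] at h1
    have h2 : (0 : M.Space) = ket C := by
      have := congrArg (fun T : M.Space →L[ℂ] M.Space => T (ket C)) h1
      simpa using this
    have h3 : ‖ket C‖ = 1 := by simp [ket]
    rw [← h2, norm_zero] at h3
    exact zero_ne_one h3
  have h := LinearMap.extendOfNorm_eq (f := M.W) denseRange_spanKet hb (Finsupp.single C 1)
  simpa [W, spanKet, U] using h

/-- The `k`-th q-configuration `|φ_k⟩ = U^k |φ⟩` of the computation on `φ`. -/
noncomputable def comp (φ : M.Space) (k : ℕ) : M.Space := (M.U ^ k) φ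

/-- Initial q-configurations: unit vectors supported on initial configurations. -/
def IsInitialQConf (φ : M.Space) : Prop :=
  ‖φ‖ = 1 ∧ ∀ C : M.Conf, φ C ≠ 0 → C.IsInitial

/-- `P_φ(n)`: the sum of `|φ(C)|²` over the final configurations `C` with `val C = n`. -/
noncomputable def ppd (φ : M.Space) (n : ℕ) : ℝ :=
  ∑' C : {C : M.Conf // C.IsFinal ∧ C.val = n}, ‖φ C.1‖ ^ 2

/-- The computed output of `M` on `φ`: the pointwise limit of the sequence `P_{φ_k}`. -/
noncomputable def computedOutput (φ : M.Space) (n : ℕ) : ℝ :=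
  limUnder atTop (fun k : ℕ => ppd (comp φ k) n)

open Classical in
/-- The component `φ_nf` of `φ` on the non-final configurations. -/
noncomputable def nonFinalPart (φ : M.Space) : M.Space :=
  ⟨fun C => if C.IsFinal then 0 else φ C, by
    refine (lp.memℓp φ).mono' fun C => ?_
    split_ifs <;> simp⟩

/-- An output measurement of `φ` leaves the q-configuration `ψ`: either
(`o = some C`) it observes a final configuration `C` with `φ(C) ≠ 0` and `φ` collapses into
`(φ(C)/|φ(C)|)|C⟩`, or (`o = none`) it observes no final configuration, where `φ_nf ≠ 0`, and
`φ` collapses into `φ_nf / ‖φ_nf‖`. -/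
def IsObservation (φ : M.Space) : Option M.Conf → M.Space → Prop
  | some C, ψ => C.IsFinal ∧ φ C ≠ 0 ∧ ψ = (φ C / (‖φ C‖ : ℂ)) • ket C
  | none, ψ => nonFinalPart φ ≠ 0 ∧ ψ = ((‖nonFinalPart φ‖⁻¹ : ℝ) : ℂ) • nonFinalPart φ

/-- The result of an observation is determined by the two q-configurations. -/
theorem IsObservation.unique {φ ψ : M.Space} {o o' : Option M.Conf}
    (h : IsObservation φ o ψ) (h' : IsObservation φ o' ψ) : o = o' := by
  classical
  have key : ∀ C : M.Conf, IsObservation φ (some C) ψ →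
      ∀ o' : Option M.Conf, IsObservation φ o' ψ → some C = o' := by
    rintro C ⟨hf, hne, h1⟩ o' h'
    have hC : ψ C ≠ 0 := by
      rw [h1]
      simp [ket, hne]
    cases o' with
    | none =>
      exfalso
      apply hC
      rw [h'.2]
      simp [nonFinalPart, hf]
    | some D =>
      by_contra hCD
      apply hC
      rw [h'.2.2]
      have hCD' : C ≠ D := fun e => hCD (by rw [e])
      simp [ket, hCD']
  cases o with
  | some C => exact key C h o' h'
  | none =>
    cases o' with
    | none => rfl
    | some D => exact (key D h' none h).symm

open Classical in
/-- The result of the output measurement of `φ` that leaves `ψ` (unique by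
`IsObservation.unique`; `none` if there is no such measurement). -/
noncomputable def obsResult (φ ψ : M.Space) : Option M.Conf :=
  if h : ∃ o, IsObservation φ o ψ then h.choose else none

theorem IsObservation.obsResult_eq {φ ψ : M.Space} {o : Option M.Conf}
    (h : IsObservation φ o ψ) : obsResult φ ψ = o := by
  have h' : ∃ o, IsObservation φ o ψ := ⟨o, h⟩
  rw [obsResult, dif_pos h']
  exact h'.choose_spec.unique h

/-- The observed output `x ∈ ℕ ∪ {⊥}` of the observation leading from `φ` to `ψ`
(`none` stands for `⊥`). -/
noncomputable def obsValue (φ ψ : M.Space) : Option ℕ := (obsResult φ ψ).map Conf.val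

/-- The probability of the output observation leading from `φ` to `ψ`: `|φ(C)|²` if it observes
the final configuration `C`, and `‖φ_nf‖²` if it observes no final configuration. -/
noncomputable def obsProb (φ ψ : M.Space) : ℝ :=
  match obsResult φ ψ with
  | some C => ‖φ C‖ ^ 2
  | none => ‖nonFinalPart φ‖ ^ 2

/-- The `τ`-observed runs on `φ`. -/
def ObservedRun (φ : M.Space) (τ : ℕ → ℕ) : Type _ :=
  {R : ℕ → M.Space // R 0 = φ ∧ ∀ h : ℕ,
    (h ∈ Set.range τ → ∃ o, IsObservation (M.U (R h)) o (R (h + 1))) ∧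
    (h ∉ Set.range τ → R (h + 1) = M.U (R h))}

/-- The prefix `R[k] = (R_0, …, R_k)` of length `k + 1` of an observed run. -/
def ObservedRun.take {φ : M.Space} {τ : ℕ → ℕ} (R : ObservedRun φ τ) (k : ℕ) :
    Fin (k + 1) → M.Space := fun i => R.1 i

/-- The finite `τ`-observed runs of length `k` on `φ`: the prefixes `R[k]` of the observed
runs. -/
def FiniteRun (φ : M.Space) (τ : ℕ → ℕ) (k : ℕ) : Type _ :=
  {r : Fin (k + 1) → M.Space // ∃ R : ObservedRun φ τ, r = R.take k}

open Classical in
/-- The probability of a finite run: the product of the probabilities of its observations,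
defined by induction on the length. -/
noncomputable def seqProb (τ : ℕ → ℕ) : (k : ℕ) → (Fin (k + 1) → M.Space) → ℝ
  | 0, _ => 1
  | k + 1, r =>
    if k ∈ Set.range τ then
      seqProb τ k (Fin.init r) * obsProb (M.U (r (Fin.last k).castSucc)) (r (Fin.last (k + 1)))
    else seqProb τ k (Fin.init r)

/-- The probability `Pr R[k]` of a finite run. -/
noncomputable def FiniteRun.prob {φ : M.Space} {τ : ℕ → ℕ} {k : ℕ} (r : FiniteRun φ τ k) : ℝ :=
  seqProb τ k r.1

/-- The probability `Pr R = lim_k Pr R[k]` of an observed run. -/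
noncomputable def ObservedRun.prob {φ : M.Space} {τ : ℕ → ℕ} (R : ObservedRun φ τ) : ℝ :=
  limUnder atTop (fun k : ℕ => seqProb τ k (R.take k))

/-- The observed output of a finite run of length `τ i + 1`: the result of its last observation,
which is made on its last step. -/
noncomputable def FiniteRun.output {φ : M.Space} {τ : ℕ → ℕ} {i : ℕ}
    (r : FiniteRun φ τ (τ i + 1)) : Option ℕ :=
  obsValue (M.U (r.1 (Fin.last (τ i)).castSucc)) (r.1 (Fin.last (τ i + 1)))

/-- The output sequence `x_i` of an observed run. -/
noncomputable def ObservedRun.outputSeq {φ : M.Space} {τ : ℕ → ℕ} (R : ObservedRun φ τ)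
    (i : ℕ) : Option ℕ :=
  obsValue (M.U (R.1 (τ i))) (R.1 (τ i + 1))

/-- The observed output of an observed run: it is `n ∈ ℕ` if `x_i = n` for some `i`, and `⊥`
if there is no such `n`. -/
def ObservedRun.HasOutput {φ : M.Space} {τ : ℕ → ℕ} (R : ObservedRun φ τ) : Option ℕ → Prop
  | some n => ∃ i, R.outputSeq i = some n
  | none => ∀ i, R.outputSeq i = none

/-- The probability of a set of observed runs: the sum of their probabilities. -/
noncomputable def ObservedRun.Pr {φ : M.Space} {τ : ℕ → ℕ} (B : Set (ObservedRun φ τ)) : ℝ≥0∞ :=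
  ∑' R : B, ENNReal.ofReal R.1.prob

/-- The probability of a set of finite observed runs of length `k`: the sum of their
probabilities. -/
noncomputable def FiniteRun.Pr {φ : M.Space} {τ : ℕ → ℕ} {k : ℕ} (B : Set (FiniteRun φ τ k)) :
    ℝ≥0∞ :=
  ∑' r : B, ENNReal.ofReal r.1.prob

end PreQTM

namespace PreQTM

variable {Q S : Type*} [Fintype Q] [Fintype S] [Inhabited S] {M : PreQTM Q S}

/-! On a final configuration a QTM only increments the counter, so `U` shifts the final amplitudes
and leaves the values `val` alone. Since `U` is an isometry, nothing interferes with the shifted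
amplitudes (`IsQTM.U_apply_inc`). All other amplitudes of `U ψ`, among them the fresh final ones
with counter `0`, depend only on the non-final part of `ψ` (`IsQTM.U_nonFinalPart_apply`).

Erasing the final part at observed times therefore does not disturb the rest of the evolution. The
unnormalised vector `branch`, on which every observation so far gave `⊥`, has the same non-final
part as `comp`, and the mass of output `n` in `comp φ k` is the mass still in `branch` plus the
masses erased earlier (`IsQTM.eppd_comp`). Just after an observation only the erased masses remain.

On the side of runs, once a final configuration has been observed the run is deterministic, with the
same output and probability `1` for later observations. A run with output `n` is thus given by its
exit: the time `h` and configuration `C` of its first final observation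
(`ObservedRun.exists_eq_path`). The normalisations telescope, so its probability is `‖U (branch h)
C‖²` (`IsExit.seqProb_of_gt`). Summing over exits gives the erased masses; monotonicity of `ppd`
gives the limit. -/

theorem ket_apply_self (C : M.Conf) : ket C C = 1 := by
  classical
  simp [ket]

theorem ket_apply_of_ne {C D : M.Conf} (h : D ≠ C) : ket C D = 0 := by
  classical
  simp [ket, h]

theorem norm_ket (C : M.Conf) : ‖ket C‖ = 1 := by
  simp [ket]

theorem inner_ket_left (C : M.Conf) (ψ : M.Space) : inner ℂ (ket C) ψ = ψ C := by
  classical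
  rw [ket, lp.inner_single_left]
  simp

/-! ### Unitarity and the shift on final configurations -/

theorem IsQTM.norm_U (hM : M.IsQTM) (ψ : M.Space) : ‖M.U ψ‖ = ‖ψ‖ := by
  exact (ContinuousLinearMap.norm_map_iff_adjoint_comp_self M.U).2 hM.1 ψ

theorem IsQTM.inner_U (hM : M.IsQTM) (ψ χ : M.Space) :
    inner ℂ (M.U ψ) (M.U χ) = inner ℂ ψ χ :=
  (ContinuousLinearMap.inner_map_map_iff_adjoint_comp_self M.U).2 hM.1 ψ χ

/-- Otherwise a basis vector in such a state, with nonzero counter, would be sent to a sum of two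
orthogonal basis vectors, of norm `√2`. -/
theorem IsQTM.disjoint (hM : M.IsQTM) {q : Q} (hs : q ∈ M.source) : q ∉ M.target := by
  intro ht
  -- Counter `1` switches off `W₀` and switches on `Wₛ`, whose result has counter `0`, while that of
  -- `Wₜ` has counter `2`.
  let C : M.Conf := ⟨default, q, 1, fun h => absurd hs h⟩
  have h := hM.U_ket C
  rw [W₀, Wₛ, Wₜ, dif_neg (fun h => h.2 ht), dif_pos ⟨hs, one_ne_zero⟩, dif_pos ht, zero_add] at h
  have hne : C.dec hs ≠ C.inc ht := fun e => by
    have := congrArg Conf.counter e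
    simp [Conf.dec, Conf.inc] at this
  have h1 := inner_ket_left (C.dec hs) (ket (C.inc ht))
  rw [ket_apply_of_ne hne] at h1
  have h2 := norm_add_sq_eq_norm_sq_add_norm_sq_of_inner_eq_zero _ _ h1
  rw [← h, hM.norm_U, norm_ket, norm_ket, norm_ket] at h2
  norm_num at h2

theorem Conf.IsFinal.mem_target {C : M.Conf} (h : C.IsFinal) : C.state ∈ M.target := by
  rw [show C.state = M.final from h]
  exact M.final_mem

theorem IsQTM.U_ket_of_isFinal (hM : M.IsQTM) {C : M.Conf} (h : C.IsFinal) :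
    M.U (ket C) = ket (C.inc h.mem_target) := by
  rw [hM.U_ket, W₀, Wₛ, Wₜ, dif_neg (fun h' => h'.2 h.mem_target),
    dif_neg (fun h' => hM.disjoint h'.1 h.mem_target), dif_pos h.mem_target]
  simp

/-- The amplitude is an inner product with `ket (C.inc _) = U (ket C)`, and `U` preserves inner
products. -/
theorem IsQTM.U_apply_inc (hM : M.IsQTM) {C : M.Conf} (h : C.IsFinal) (ψ : M.Space) :
    M.U ψ (C.inc h.mem_target) = ψ C := by
  rw [← inner_ket_left, ← hM.U_ket_of_isFinal h, hM.inner_U, inner_ket_left]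

/-! ### The non-final part and its evolution -/

theorem nonFinalPart_apply_of_isFinal (ψ : M.Space) {C : M.Conf} (h : C.IsFinal) :
    nonFinalPart ψ C = 0 :=
  if_pos h

theorem nonFinalPart_apply_of_not_isFinal (ψ : M.Space) {C : M.Conf} (h : ¬ C.IsFinal) :
    nonFinalPart ψ C = ψ C :=
  if_neg h

theorem nonFinalPart_smul (c : ℂ) (ψ : M.Space) :
    nonFinalPart (c • ψ) = c • nonFinalPart ψ := by
  ext C
  by_cases h : C.IsFinal
  · simp [nonFinalPart_apply_of_isFinal _ h]
  · simp [nonFinalPart_apply_of_not_isFinal _ h]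

theorem nonFinalPart_nonFinalPart (ψ : M.Space) :
    nonFinalPart (nonFinalPart ψ) = nonFinalPart ψ := by
  ext C
  by_cases h : C.IsFinal
  · simp [nonFinalPart_apply_of_isFinal _ h]
  · simp [nonFinalPart_apply_of_not_isFinal _ h]

theorem nonFinalPart_ket {C : M.Conf} (h : C.IsFinal) : nonFinalPart (ket C) = 0 := by
  ext D
  by_cases hD : D.IsFinal
  · simp [nonFinalPart_apply_of_isFinal _ hD]
  · rw [nonFinalPart_apply_of_not_isFinal _ hD, ket_apply_of_ne (fun e : D = C => hD (e ▸ h))]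
    simp

/-- The amplitudes of `U ψ` that are not merely shifted amplitudes of final configurations
depend only on the non-final part of `ψ`. -/
theorem IsQTM.U_nonFinalPart_apply (hM : M.IsQTM) (ψ : M.Space) {C : M.Conf}
    (hC : ¬ (C.IsFinal ∧ C.counter ≠ 0)) : M.U (nonFinalPart ψ) C = M.U ψ C := by
  have h : M.U (ψ - nonFinalPart ψ) C = 0 := by
    -- Passing to the adjoint reduces the claim to single coordinates: at a final `D` the adjoint
    -- factor is `⟨ket (D.inc _), ket C⟩ = 0`, and at other `D` the difference vanishes.
    rw [← inner_ket_left, ← ContinuousLinearMap.adjoint_inner_left, lp.inner_eq_tsum]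
    refine (tsum_congr fun D => ?_).trans tsum_zero
    by_cases hD : D.IsFinal
    · have hne : D.inc hD.mem_target ≠ C := fun e => hC ⟨e ▸ hD, by simp [← e, Conf.inc]⟩
      have h0 : (ContinuousLinearMap.adjoint M.U (ket C)) D = 0 := by
        rw [← inner_ket_left, ContinuousLinearMap.adjoint_inner_right, hM.U_ket_of_isFinal hD,
          inner_ket_left, ket_apply_of_ne hne]
      rw [h0, inner_zero_left]
    · have h0 : (ψ - nonFinalPart ψ) D = 0 := by
        rw [lp.coeFn_sub, Pi.sub_apply, nonFinalPart_apply_of_not_isFinal _ hD, sub_self]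
      rw [h0, inner_zero_right]
  rw [map_sub, lp.coeFn_sub, Pi.sub_apply, sub_eq_zero] at h
  exact h.symm

theorem IsQTM.nonFinalPart_U_nonFinalPart (hM : M.IsQTM) (ψ : M.Space) :
    nonFinalPart (M.U (nonFinalPart ψ)) = nonFinalPart (M.U ψ) := by
  ext C
  by_cases h : C.IsFinal
  · simp [nonFinalPart_apply_of_isFinal _ h]
  · rw [nonFinalPart_apply_of_not_isFinal _ h, nonFinalPart_apply_of_not_isFinal _ h,
      hM.U_nonFinalPart_apply ψ (fun h' => h h'.1)]

theorem IsQTM.iterate_ket (hM : M.IsQTM) {C : M.Conf} (h : C.IsFinal) (j : ℕ) :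
    ∃ D : M.Conf, D.IsFinal ∧ D.val = C.val ∧ (M.U ^ j) (ket C) = ket D := by
  induction j with
  | zero => exact ⟨C, h, rfl, rfl⟩
  | succ j ih =>
    obtain ⟨D, hD, hv, he⟩ := ih
    refine ⟨D.inc hD.mem_target, hD, hv, ?_⟩
    rw [pow_succ', mul_apply_eq_comp, he, hM.U_ket_of_isFinal hD]

/-! ### Output probabilities and their growth in one step -/

/-- `P_ψ(n)` as an extended non-negative real number. -/
noncomputable def eppd (ψ : M.Space) (n : ℕ) : ℝ≥0∞ :=
  ∑' C : {C : M.Conf // C.IsFinal ∧ C.val = n}, ‖ψ C.1‖ₑ ^ 2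

theorem summable_norm_sq (ψ : M.Space) : Summable fun C => ‖ψ C‖ ^ 2 := by
  simpa using (lp.memℓp ψ).summable (by simp)

theorem ofReal_norm_sq (z : ℂ) : ENNReal.ofReal (‖z‖ ^ 2) = ‖z‖ₑ ^ 2 := by
  rw [ENNReal.ofReal_pow (norm_nonneg _), ofReal_norm]

theorem ofReal_ppd (ψ : M.Space) (n : ℕ) : ENNReal.ofReal (ppd ψ n) = eppd ψ n := by
  exact (ENNReal.ofReal_tsum_of_nonneg (fun _ => sq_nonneg _)
    ((summable_norm_sq ψ).comp_injective Subtype.val_injective)).trans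
    (tsum_congr fun C => ofReal_norm_sq _)

theorem ppd_nonneg (ψ : M.Space) (n : ℕ) : 0 ≤ ppd ψ n :=
  tsum_nonneg fun _ => by positivity

theorem ppd_le (ψ : M.Space) (n : ℕ) : ppd ψ n ≤ ‖ψ‖ ^ 2 := by
  have h : ‖ψ‖ ^ 2 = ∑' C, ‖ψ C‖ ^ 2 := by
    simpa using lp.norm_rpow_eq_tsum (p := 2) (by simp) ψ
  rw [h]
  exact (summable_norm_sq ψ).tsum_subtype_le _ {C | C.IsFinal ∧ C.val = n}
    (fun _ => by positivity)

theorem eppd_nonFinalPart (ψ : M.Space) (n : ℕ) : eppd (nonFinalPart ψ) n = 0 := by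
  refine ENNReal.tsum_eq_zero.2 fun C => ?_
  rw [nonFinalPart_apply_of_isFinal _ C.2.1]
  simp

/-- The part of `P_{U ψ}(n)` due to final configurations just reached, with counter `0`. -/
noncomputable def freshPpd (ψ : M.Space) (n : ℕ) : ℝ≥0∞ :=
  ∑' C : {C : M.Conf // (C.IsFinal ∧ C.val = n) ∧ C.counter = 0}, ‖M.U ψ C.1‖ₑ ^ 2

theorem IsQTM.freshPpd_nonFinalPart (hM : M.IsQTM) (ψ : M.Space) (n : ℕ) :
    freshPpd (nonFinalPart ψ) n = freshPpd ψ n :=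
  tsum_congr fun C => by rw [hM.U_nonFinalPart_apply ψ (fun h => h.2 C.2.2)]

/-- A final configuration with positive counter is the increment of a unique final configuration
with the same value, whose amplitude it inherits. Those with counter `0` make up the fresh part. -/
theorem IsQTM.eppd_U (hM : M.IsQTM) (ψ : M.Space) (n : ℕ) :
    eppd (M.U ψ) n = eppd ψ n + freshPpd ψ n := by
  let e : {C : M.Conf // C.IsFinal ∧ C.val = n} ⊕
      {C : M.Conf // (C.IsFinal ∧ C.val = n) ∧ C.counter = 0} →
      {C : M.Conf // C.IsFinal ∧ C.val = n} :=
    Sum.elim (fun C => ⟨C.1.inc C.2.1.mem_target, C.2⟩) (fun C => ⟨C.1, C.2.1⟩)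
  have he : Function.Bijective e := by
    constructor
    · rintro (⟨C, hC⟩ | ⟨C, hC⟩) (⟨D, hD⟩ | ⟨D, hD⟩) h <;>
        simp [e, Conf.ext_iff, Conf.inc] at h ⊢
      · exact h
      · exact absurd hD.2 (by omega)
      · exact absurd hC.2 (by omega)
      · exact h
    · rintro ⟨C, hC⟩
      by_cases h0 : C.counter = 0
      · exact ⟨Sum.inr ⟨C, hC, h0⟩, rfl⟩
      · refine ⟨Sum.inl ⟨⟨C.tape, C.state, C.counter - 1,
          fun _ h => absurd hC.1.mem_target h⟩, hC⟩, ?_⟩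
        simp [e, Conf.ext_iff, Conf.inc]
        omega
  rw [eppd, ← (Equiv.ofBijective e he).tsum_eq,
    ENNReal.summable.tsum_sum ENNReal.summable]
  congr 1
  exact tsum_congr fun C => by
    simp [e, hM.U_apply_inc C.2.1]

/-! ### Normalisation and phase -/

/-- The vector divided by its norm. -/
noncomputable def nrm (ψ : M.Space) : M.Space := ((‖ψ‖⁻¹ : ℝ) : ℂ) • ψ

theorem nrm_ofReal_smul {c : ℝ} (hc : 0 < c) (ψ : M.Space) : nrm ((c : ℂ) • ψ) = nrm ψ := by
  rw [nrm, nrm, norm_smul, Complex.norm_real, Real.norm_of_nonneg hc.le, smul_smul,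
    ← Complex.ofReal_mul]
  congr 2
  rw [mul_inv, mul_comm c⁻¹, mul_assoc, inv_mul_cancel₀ hc.ne', mul_one]

theorem nrm_eq_self {ψ : M.Space} (h : ‖ψ‖ = 1) : nrm ψ = ψ := by
  simp [nrm, h]

theorem IsQTM.U_nrm (hM : M.IsQTM) (ψ : M.Space) : M.U (nrm ψ) = nrm (M.U ψ) := by
  rw [nrm, nrm, map_smul, hM.norm_U]

/-- The unit complex number of the same direction. -/
noncomputable def phase (z : ℂ) : ℂ := z / (‖z‖ : ℂ)

theorem norm_phase {z : ℂ} (h : z ≠ 0) : ‖phase z‖ = 1 := by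
  simp [phase, h]

theorem phase_ofReal_mul {c : ℝ} (hc : 0 < c) (z : ℂ) : phase ((c : ℂ) * z) = phase z := by
  rw [phase, phase, norm_mul, Complex.norm_real, Real.norm_of_nonneg hc.le, Complex.ofReal_mul,
    mul_div_mul_left _ _ (Complex.ofReal_ne_zero.2 hc.ne')]

/-! ### The branch without final observations -/

/-- What remains of `φ` (not normalised) after `h` steps, when every measurement made at the
times in `τ` observes no final configuration. -/
noncomputable def branch (φ : M.Space) (τ : ℕ → ℕ) : ℕ → M.Space
  | 0 => φ
  | h + 1 => open Classical in
    if h ∈ Set.range τ then nonFinalPart (M.U (branch φ τ h)) else M.U (branch φ τ h)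

section branch

variable {φ : M.Space} {τ : ℕ → ℕ}

theorem branch_succ_of_mem {h : ℕ} (hh : h ∈ Set.range τ) :
    branch φ τ (h + 1) = nonFinalPart (M.U (branch φ τ h)) := by
  rw [branch, if_pos hh]

theorem branch_succ_of_notMem {h : ℕ} (hh : h ∉ Set.range τ) :
    branch φ τ (h + 1) = M.U (branch φ τ h) := by
  rw [branch, if_neg hh]

theorem nonFinalPart_zero : nonFinalPart (0 : M.Space) = 0 := by
  simpa using nonFinalPart_smul (0 : ℂ) (0 : M.Space)

theorem branch_ne_zero_of_succ {h : ℕ} (hne : branch φ τ (h + 1) ≠ 0) : branch φ τ h ≠ 0 := by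
  intro h0
  apply hne
  by_cases hh : h ∈ Set.range τ
  · rw [branch_succ_of_mem hh, h0, map_zero, nonFinalPart_zero]
  · rw [branch_succ_of_notMem hh, h0, map_zero]

theorem branch_ne_zero_of_le {t h : ℕ} (hth : t ≤ h) (hne : branch φ τ h ≠ 0) :
    branch φ τ t ≠ 0 := by
  induction h, hth using Nat.le_induction with
  | base => exact hne
  | succ h _ ih => exact ih (branch_ne_zero_of_succ hne)

theorem branch_ne_zero_of_apply_ne_zero {h : ℕ} {C : M.Conf}
    (hne : M.U (branch φ τ h) C ≠ 0) : branch φ τ h ≠ 0 := fun h0 => hne (by rw [h0, map_zero]; rfl)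

theorem comp_succ (φ : M.Space) (k : ℕ) : comp φ (k + 1) = M.U (comp φ k) := by
  rw [comp, pow_succ', mul_apply_eq_comp]
  rfl

/-- The non-final part evolves autonomously, so erasing final amplitudes does not affect it. -/
theorem IsQTM.nonFinalPart_branch (hM : M.IsQTM) (h : ℕ) :
    nonFinalPart (branch φ τ h) = nonFinalPart (comp φ h) := by
  induction h with
  | zero => rfl
  | succ h ih =>
    have key : nonFinalPart (M.U (branch φ τ h)) = nonFinalPart (comp φ (h + 1)) := by
      rw [comp_succ, ← hM.nonFinalPart_U_nonFinalPart, ih, hM.nonFinalPart_U_nonFinalPart]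
    by_cases hh : h ∈ Set.range τ
    · rw [branch_succ_of_mem hh, nonFinalPart_nonFinalPart, key]
    · rw [branch_succ_of_notMem hh, key]

open Classical in
/-- The probability that the first observation of a final configuration is made at time `h`, with
output `n`. -/
noncomputable def firstPpd (φ : M.Space) (τ : ℕ → ℕ) (n h : ℕ) : ℝ≥0∞ :=
  if h ∈ Set.range τ then eppd (M.U (branch φ τ h)) n else 0

/-- Both vectors gain the same fresh mass at each step, because they have the same non-final part.
At an observed time the mass of the branch moves into the sum. -/
theorem IsQTM.eppd_comp (hM : M.IsQTM) (n k : ℕ) :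
    eppd (comp φ k) n = eppd (branch φ τ k) n + ∑ h ∈ Finset.range k, firstPpd φ τ n h := by
  induction k with
  | zero => simp [comp, branch]
  | succ k ih =>
    have hf : freshPpd (comp φ k) n = freshPpd (branch φ τ k) n := by
      rw [← hM.freshPpd_nonFinalPart, ← hM.nonFinalPart_branch (τ := τ),
        hM.freshPpd_nonFinalPart]
    have hU := hM.eppd_U (branch φ τ k) n
    rw [comp_succ, hM.eppd_U, ih, hf, Finset.sum_range_succ, firstPpd]
    by_cases hk : k ∈ Set.range τ
    · rw [if_pos hk, branch_succ_of_mem hk, eppd_nonFinalPart, hU]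
      ring
    · rw [if_neg hk, branch_succ_of_notMem hk, hU]
      ring

theorem IsQTM.eppd_comp_observed (hM : M.IsQTM) (n i : ℕ) :
    eppd (comp φ (τ i + 1)) n = ∑ h ∈ Finset.range (τ i + 1), firstPpd φ τ n h := by
  rw [hM.eppd_comp (τ := τ), branch_succ_of_mem ⟨i, rfl⟩, eppd_nonFinalPart, zero_add]

end branch

/-! ### The computed output as a limit -/

theorem IsQTM.norm_comp (hM : M.IsQTM) (φ : M.Space) (k : ℕ) : ‖comp φ k‖ = ‖φ‖ := by
  induction k with
  | zero => rfl
  | succ k ih => rw [comp_succ, hM.norm_U, ih]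

theorem IsQTM.tendsto_ppd_comp (hM : M.IsQTM) (φ : M.Space) (n : ℕ) :
    Tendsto (fun k => ppd (comp φ k) n) atTop (𝓝 (computedOutput φ n)) := by
  have hmono : Monotone fun k => ppd (comp φ k) n := by
    refine monotone_nat_of_le_succ fun k => ?_
    rw [← ENNReal.ofReal_le_ofReal_iff (ppd_nonneg _ _), ofReal_ppd, ofReal_ppd, comp_succ,
      hM.eppd_U]
    exact le_self_add
  have hbdd : BddAbove (Set.range fun k => ppd (comp φ k) n) := by
    refine ⟨‖φ‖ ^ 2, ?_⟩
    rintro _ ⟨k, rfl⟩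
    have := ppd_le (comp φ k) n
    rwa [hM.norm_comp] at this
  exact tendsto_nhds_limUnder ⟨_, tendsto_atTop_ciSup hmono hbdd⟩

/-- Both sides are limits along the times `τ i + 1`, where the partial sums are exactly the output
probabilities. -/
theorem IsQTM.tsum_firstPpd (hM : M.IsQTM) (φ : M.Space) {τ : ℕ → ℕ} (hτ : StrictMono τ) (n : ℕ) :
    ∑' h, firstPpd φ τ n h = ENNReal.ofReal (computedOutput φ n) := by
  have hi : Tendsto (fun i => τ i + 1) atTop atTop :=
    tendsto_atTop_mono (fun _ => Nat.le_succ _) hτ.tendsto_atTop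
  have h1 := (ENNReal.tendsto_nat_tsum (firstPpd φ τ n)).comp hi
  have h2 := (ENNReal.continuous_ofReal.tendsto _).comp ((hM.tendsto_ppd_comp φ n).comp hi)
  refine tendsto_nhds_unique h1 (h2.congr fun i => ?_)
  simp only [Function.comp_apply]
  rw [ofReal_ppd, hM.eppd_comp_observed]

/-! ### Observations of final basis vectors and of normalised branches -/

theorem isObservation_smul_ket {c : ℂ} (hc : ‖c‖ = 1) {C : M.Conf} (h : C.IsFinal) :
    IsObservation (c • ket C) (some C) (c • ket C) := by
  have hv : (c • ket C) C = c := by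
    rw [lp.coeFn_smul, Pi.smul_apply, ket_apply_self, smul_eq_mul, mul_one]
  refine ⟨h, ?_, ?_⟩
  · rw [hv]
    exact norm_ne_zero_iff.1 (by rw [hc]; exact one_ne_zero)
  · rw [hv, hc, Complex.ofReal_one, div_one]

theorem eq_of_isObservation_smul_ket {c : ℂ} (hc : ‖c‖ = 1) {C : M.Conf} (h : C.IsFinal)
    {o : Option M.Conf} {ψ : M.Space} (ho : IsObservation (c • ket C) o ψ) : ψ = c • ket C := by
  cases o with
  | none =>
    exact absurd (by rw [nonFinalPart_smul, nonFinalPart_ket h, smul_zero]) ho.1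
  | some D =>
    have hD : D = C := by
      by_contra hne
      apply ho.2.1
      rw [lp.coeFn_smul, Pi.smul_apply, ket_apply_of_ne hne, smul_zero]
    subst hD
    rw [ho.2.2, (isObservation_smul_ket hc h).2.2]
    simp [ket_apply_self, hc]

section runs

variable {φ : M.Space} {τ : ℕ → ℕ}

theorem nrm_nonFinalPart_U_nrm {ψ : M.Space} (h : ψ ≠ 0) :
    nrm (nonFinalPart (M.U (nrm ψ))) = nrm (nonFinalPart (M.U ψ)) := by
  rw [show nrm ψ = ((‖ψ‖⁻¹ : ℝ) : ℂ) • ψ from rfl, map_smul, nonFinalPart_smul,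
    nrm_ofReal_smul (inv_pos.2 (norm_pos_iff.2 h))]

theorem U_nrm_apply (ψ : M.Space) (C : M.Conf) :
    M.U (nrm ψ) C = ((‖ψ‖⁻¹ : ℝ) : ℂ) * M.U ψ C := by
  rw [nrm, map_smul]
  rfl

theorem phase_U_nrm {ψ : M.Space} (h : ψ ≠ 0) (C : M.Conf) :
    phase (M.U (nrm ψ) C) = phase (M.U ψ C) := by
  rw [U_nrm_apply, phase_ofReal_mul (inv_pos.2 (norm_pos_iff.2 h))]

theorem U_nrm_apply_ne_zero {ψ : M.Space} {C : M.Conf} (h : M.U ψ C ≠ 0) :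
    M.U (nrm ψ) C ≠ 0 := by
  have hψ : ψ ≠ 0 := fun h0 => h (by rw [h0, map_zero]; rfl)
  rw [U_nrm_apply]
  exact mul_ne_zero (Complex.ofReal_ne_zero.2 (inv_ne_zero (norm_ne_zero_iff.2 hψ))) h

theorem isObservation_branch_none {k : ℕ} (hk : k ∈ Set.range τ) (hne : branch φ τ (k + 1) ≠ 0) :
    IsObservation (M.U (nrm (branch φ τ k))) none (nrm (branch φ τ (k + 1))) := by
  have h0 := branch_ne_zero_of_succ hne
  rw [branch_succ_of_mem hk] at hne ⊢
  refine ⟨?_, (nrm_nonFinalPart_U_nrm h0).symm⟩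
  rw [nrm, map_smul, nonFinalPart_smul]
  exact smul_ne_zero (Complex.ofReal_ne_zero.2 (inv_ne_zero (norm_ne_zero_iff.2 h0))) hne

theorem isObservation_branch_some {ψ : M.Space} {C : M.Conf} (hC : C.IsFinal)
    (hne : M.U ψ C ≠ 0) :
    IsObservation (M.U (nrm ψ)) (some C) (phase (M.U ψ C) • ket C) := by
  have hψ : ψ ≠ 0 := fun h0 => hne (by rw [h0, map_zero]; rfl)
  exact ⟨hC, U_nrm_apply_ne_zero hne, by rw [← phase_U_nrm hψ]; rfl⟩

/-! ### Exits and the runs they determine -/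

/-- It has positive probability that the first observation of a final configuration is made
at time `h` and observes `C`. -/
structure IsExit (φ : M.Space) (τ : ℕ → ℕ) (h : ℕ) (C : M.Conf) : Prop where
  mem : h ∈ Set.range τ
  isFinal : C.IsFinal
  ne_zero : M.U (branch φ τ h) C ≠ 0

/-- The run whose first observation of a final configuration is made at time `h` and
observes `C`. -/
noncomputable def path (φ : M.Space) (τ : ℕ → ℕ) (h : ℕ) (C : M.Conf) (t : ℕ) : M.Space :=
  if t ≤ h then nrm (branch φ τ t)
  -- The observation made at time `h` shows in the vector at time `h + 1`, where the exponent is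
  -- `0`.
  else phase (M.U (branch φ τ h) C) • (M.U ^ (t - h - 1)) (ket C)

theorem path_of_le {t h : ℕ} (hth : t ≤ h) (C : M.Conf) :
    path φ τ h C t = nrm (branch φ τ t) :=
  if_pos hth

theorem path_of_lt {t h : ℕ} (hth : h < t) (C : M.Conf) :
    path φ τ h C t = phase (M.U (branch φ τ h) C) • (M.U ^ (t - h - 1)) (ket C) :=
  if_neg hth.not_ge

theorem path_succ_self (h : ℕ) (C : M.Conf) :
    path φ τ h C (h + 1) = phase (M.U (branch φ τ h) C) • ket C := by
  rw [path_of_lt h.lt_succ_self, Nat.succ_eq_add_one, Nat.add_sub_cancel_left]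
  rfl

theorem path_succ_of_lt {t h : ℕ} (hth : h < t) (C : M.Conf) :
    path φ τ h C (t + 1) = M.U (path φ τ h C t) := by
  rw [path_of_lt hth, path_of_lt (hth.trans t.lt_succ_self), map_smul,
    show t + 1 - h - 1 = (t - h - 1) + 1 by omega, pow_succ', mul_apply_eq_comp]

theorem IsQTM.path_eq_smul_ket (hM : M.IsQTM) {t h : ℕ} (hth : h < t) {C : M.Conf}
    (hC : C.IsFinal) : ∃ D : M.Conf, D.IsFinal ∧ D.val = C.val ∧
      path φ τ h C t = phase (M.U (branch φ τ h) C) • ket D := by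
  obtain ⟨D, hD, hv, he⟩ := hM.iterate_ket hC (t - h - 1)
  exact ⟨D, hD, hv, by rw [path_of_lt hth, he]⟩

theorem IsExit.branch_ne_zero {h : ℕ} {C : M.Conf} (H : IsExit φ τ h C) {t : ℕ} (hth : t ≤ h) :
    branch φ τ t ≠ 0 :=
  branch_ne_zero_of_le hth (branch_ne_zero_of_apply_ne_zero H.ne_zero)

theorem IsExit.norm_phase {h : ℕ} {C : M.Conf} (H : IsExit φ τ h C) :
    ‖phase (M.U (branch φ τ h) C)‖ = 1 :=
  PreQTM.norm_phase H.ne_zero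

theorem IsExit.isObservation_of_lt {h : ℕ} {C : M.Conf} (H : IsExit φ τ h C) {t : ℕ}
    (ht : t ∈ Set.range τ) (hth : t < h) :
    IsObservation (M.U (path φ τ h C t)) none (path φ τ h C (t + 1)) := by
  rw [path_of_le hth.le, path_of_le (Nat.succ_le_of_lt hth)]
  exact isObservation_branch_none ht (H.branch_ne_zero hth)

theorem IsExit.isObservation_self {h : ℕ} {C : M.Conf} (H : IsExit φ τ h C) :
    IsObservation (M.U (path φ τ h C h)) (some C) (path φ τ h C (h + 1)) := by
  rw [path_of_le le_rfl, path_succ_self]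
  exact isObservation_branch_some H.isFinal H.ne_zero

theorem IsExit.isObservation_of_gt (hM : M.IsQTM) {h : ℕ} {C : M.Conf} (H : IsExit φ τ h C)
    {t : ℕ} (hth : h < t) : ∃ D : M.Conf, D.val = C.val ∧ ‖M.U (path φ τ h C t) D‖ = 1 ∧
      IsObservation (M.U (path φ τ h C t)) (some D) (path φ τ h C (t + 1)) := by
  obtain ⟨D, hD, hv, he⟩ :=
    hM.path_eq_smul_ket (φ := φ) (τ := τ) (hth.trans t.lt_succ_self) H.isFinal
  refine ⟨D, hv, ?_⟩
  rw [path_succ_of_lt hth] at he ⊢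
  rw [he]
  refine ⟨?_, isObservation_smul_ket H.norm_phase hD⟩
  rw [lp.coeFn_smul, Pi.smul_apply, ket_apply_self, smul_eq_mul, mul_one, H.norm_phase]

theorem IsExit.isRun (hM : M.IsQTM) (hφ : ‖φ‖ = 1) {h : ℕ} {C : M.Conf} (H : IsExit φ τ h C) :
    path φ τ h C 0 = φ ∧ ∀ t : ℕ,
      (t ∈ Set.range τ → ∃ o, IsObservation (M.U (path φ τ h C t)) o (path φ τ h C (t + 1))) ∧
      (t ∉ Set.range τ → path φ τ h C (t + 1) = M.U (path φ τ h C t)) := by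
  refine ⟨by rw [path_of_le h.zero_le]; exact nrm_eq_self hφ, fun t => ⟨fun ht => ?_, fun ht => ?_⟩⟩
  · rcases lt_trichotomy t h with hth | rfl | hth
    · exact ⟨_, H.isObservation_of_lt ht hth⟩
    · exact ⟨_, H.isObservation_self⟩
    · obtain ⟨D, -, -, hD⟩ := H.isObservation_of_gt hM hth
      exact ⟨_, hD⟩
  · rcases lt_trichotomy t h with hth | rfl | hth
    · rw [path_of_le hth.le, path_of_le (Nat.succ_le_of_lt hth), hM.U_nrm,
        branch_succ_of_notMem ht]
    · exact absurd H.mem ht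
    · exact path_succ_of_lt hth C

/-- The observed run whose first observation of a final configuration is made at time `h` and
observes `C`. -/
noncomputable def IsExit.run (hM : M.IsQTM) (hφ : ‖φ‖ = 1) {h : ℕ} {C : M.Conf}
    (H : IsExit φ τ h C) : ObservedRun φ τ :=
  ⟨path φ τ h C, H.isRun hM hφ⟩

theorem IsExit.obsValue_of_le (hM : M.IsQTM) {h : ℕ} {C : M.Conf} (H : IsExit φ τ h C)
    {t : ℕ} (hht : h ≤ t) :
    obsValue (M.U (path φ τ h C t)) (path φ τ h C (t + 1)) = some C.val := by
  rcases hht.eq_or_lt with rfl | hht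
  · rw [obsValue, H.isObservation_self.obsResult_eq, Option.map_some]
  · obtain ⟨D, hv, -, hD⟩ := H.isObservation_of_gt hM hht
    rw [obsValue, hD.obsResult_eq, Option.map_some, hv]

/-- At time `h + 1` the first path is a nonzero multiple of `ket C`, whereas a path leaving later is
then a multiple of a non-final part, hence zero at the final `C`. -/
theorem eq_of_path_succ_eq {h h' : ℕ} {C C' : M.Conf} (H : IsExit φ τ h C)
    (hle : h ≤ h') (heq : path φ τ h C (h + 1) = path φ τ h' C' (h + 1)) : h = h' ∧ C = C' := by
  rw [path_succ_self] at heq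
  have h1 : (phase (M.U (branch φ τ h) C) • ket C) C ≠ 0 := by
    rw [lp.coeFn_smul, Pi.smul_apply, ket_apply_self, smul_eq_mul, mul_one]
    exact norm_ne_zero_iff.1 (by rw [H.norm_phase]; exact one_ne_zero)
  rw [heq] at h1
  rcases hle.eq_or_lt with rfl | hlt
  · refine ⟨rfl, ?_⟩
    by_contra hne
    rw [path_succ_self, lp.coeFn_smul, Pi.smul_apply, ket_apply_of_ne hne, smul_zero] at h1
    exact h1 rfl
  · rw [path_of_le (Nat.succ_le_of_lt hlt), Nat.succ_eq_add_one, branch_succ_of_mem H.mem, nrm,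
      lp.coeFn_smul, Pi.smul_apply, nonFinalPart_apply_of_isFinal _ H.isFinal, smul_zero] at h1
    exact absurd rfl h1

theorem path_injective {h h' : ℕ} {C C' : M.Conf} (H : IsExit φ τ h C) (H' : IsExit φ τ h' C')
    {k : ℕ} (hk : h < k) (hk' : h' < k)
    (heq : ∀ t ≤ k, path φ τ h C t = path φ τ h' C' t) : h = h' ∧ C = C' := by
  rcases le_total h h' with hle | hle
  · exact eq_of_path_succ_eq H hle (heq _ hk)
  · obtain ⟨h1, h2⟩ := eq_of_path_succ_eq H' hle (heq _ hk').symm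
    exact ⟨h1.symm, h2.symm⟩

/-! ### Classification of runs -/

/-- After the observation of a final configuration a run is deterministic. -/
theorem ObservedRun.eq_iterate (hM : M.IsQTM) (R : ObservedRun φ τ) {c : ℂ} (hc : ‖c‖ = 1)
    {C : M.Conf} (hC : C.IsFinal) {t : ℕ} (ht : R.1 t = c • ket C) (j : ℕ) :
    R.1 (t + j) = c • (M.U ^ j) (ket C) := by
  induction j with
  | zero => exact ht
  | succ j ih =>
    have hU : M.U (R.1 (t + j)) = c • (M.U ^ (j + 1)) (ket C) := by
      rw [ih, map_smul, pow_succ', mul_apply_eq_comp]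
    obtain ⟨D, hD, -, he⟩ := hM.iterate_ket hC (j + 1)
    by_cases hj : t + j ∈ Set.range τ
    · obtain ⟨o, ho⟩ := (R.2.2 (t + j)).1 hj
      rw [hU, he] at ho
      rw [he]
      exact eq_of_isObservation_smul_ket hc hD ho
    · rw [← hU]
      exact (R.2.2 (t + j)).2 hj

/-- Up to any time, a run has either observed no final configuration, or it is one of the runs
`path φ τ h C`. -/
theorem ObservedRun.eq_branch_or_eq_path (hM : M.IsQTM) (hφ : ‖φ‖ = 1) (R : ObservedRun φ τ)
    (k : ℕ) : (branch φ τ k ≠ 0 ∧ R.1 k = nrm (branch φ τ k) ∧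
        ∀ t < k, t ∈ Set.range τ → obsResult (M.U (R.1 t)) (R.1 (t + 1)) = none) ∨
      ∃ h < k, ∃ C, IsExit φ τ h C ∧ R.1 = path φ τ h C := by
  -- The induction needs the whole history on the branch, so that at an exit the run agrees with
  -- `path` at the earlier times too.
  suffices H : (∀ t ≤ k, branch φ τ t ≠ 0 ∧ R.1 t = nrm (branch φ τ t)) ∨
      ∃ h < k, ∃ C, IsExit φ τ h C ∧ R.1 = path φ τ h C by
    refine H.imp_left fun H => ⟨(H k le_rfl).1, (H k le_rfl).2, fun t ht htτ => ?_⟩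
    rw [(H t ht.le).2, (H (t + 1) ht).2]
    exact (isObservation_branch_none htτ (H (t + 1) ht).1).obsResult_eq
  induction k with
  | zero =>
    refine Or.inl fun t ht => ?_
    obtain rfl := Nat.le_zero.1 ht
    refine ⟨norm_ne_zero_iff.1 (by rw [branch, hφ]; exact one_ne_zero), ?_⟩
    rw [R.2.1, branch, nrm_eq_self hφ]
  | succ k ih =>
    rcases ih with ih | ⟨h, hk, C, hC⟩
    swap
    · exact Or.inr ⟨h, hk.trans k.lt_succ_self, C, hC⟩
    obtain ⟨hne, hR⟩ := ih k le_rfl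
    have ext_left : branch φ τ (k + 1) ≠ 0 ∧ R.1 (k + 1) = nrm (branch φ τ (k + 1)) →
        ∀ t ≤ k + 1, branch φ τ t ≠ 0 ∧ R.1 t = nrm (branch φ τ t) := fun H t ht => by
      rcases Nat.le_succ_iff.1 ht with ht | rfl
      · exact ih t ht
      · exact H
    by_cases hk : k ∈ Set.range τ
    · obtain ⟨o, ho⟩ := (R.2.2 k).1 hk
      rw [hR] at ho
      cases o with
      | none =>
        refine Or.inl (ext_left ?_)
        rw [branch_succ_of_mem hk]
        refine ⟨fun h0 => ho.1 ?_, ?_⟩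
        · rw [nrm, map_smul, nonFinalPart_smul, h0, smul_zero]
        · rw [← nrm_nonFinalPart_U_nrm hne]
          exact ho.2
      | some C =>
        have HC : IsExit φ τ k C := ⟨hk, ho.1, fun h0 => ho.2.1 (by rw [U_nrm_apply, h0, mul_zero])⟩
        refine Or.inr ⟨k, k.lt_succ_self, C, HC, funext fun t => ?_⟩
        have hs : R.1 (k + 1) = phase (M.U (branch φ τ k) C) • ket C := by
          rw [← phase_U_nrm hne]
          exact ho.2.2
        rcases le_or_gt t k with htk | htk
        · rw [path_of_le htk]
          exact (ih t htk).2
        · rw [path_of_lt htk, ← R.eq_iterate hM HC.norm_phase HC.isFinal hs,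
            show k + 1 + (t - k - 1) = t by omega]
    · refine Or.inl (ext_left ?_)
      rw [branch_succ_of_notMem hk, (R.2.2 k).2 hk, hR, hM.U_nrm]
      refine ⟨fun h0 => hne ?_, rfl⟩
      rw [← norm_eq_zero, ← hM.norm_U, h0, norm_zero]

theorem ObservedRun.exists_eq_path (hM : M.IsQTM) (hφ : ‖φ‖ = 1) (R : ObservedRun φ τ) {n i : ℕ}
    (hn : R.outputSeq i = some n) :
    ∃ h < τ i + 1, ∃ C, IsExit φ τ h C ∧ C.val = n ∧ R.1 = path φ τ h C := by
  rcases R.eq_branch_or_eq_path hM hφ (τ i + 1) with ⟨-, -, H⟩ | ⟨h, hi, C, HC, he⟩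
  · rw [ObservedRun.outputSeq, obsValue, H (τ i) (τ i).lt_succ_self ⟨i, rfl⟩] at hn
    cases hn
  · refine ⟨h, hi, C, HC, ?_, he⟩
    rw [ObservedRun.outputSeq, he, HC.obsValue_of_le hM (Nat.le_of_lt_succ hi)] at hn
    exact Option.some.inj hn

/-! ### Probabilities of runs -/

theorem seqProb_succ_of_mem {k : ℕ} (hk : k ∈ Set.range τ) (R : ℕ → M.Space) :
    seqProb τ (k + 1) (fun i => R i) =
      seqProb τ k (fun i => R i) * obsProb (M.U (R k)) (R (k + 1)) := by
  rw [seqProb, if_pos hk]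
  rfl

theorem seqProb_succ_of_notMem {k : ℕ} (hk : k ∉ Set.range τ) (R : ℕ → M.Space) :
    seqProb τ (k + 1) (fun i => R i) = seqProb τ k (fun i => R i) := by
  rw [seqProb, if_neg hk]
  rfl

theorem IsObservation.obsProb_some {ψ χ : M.Space} {C : M.Conf}
    (h : IsObservation ψ (some C) χ) : obsProb ψ χ = ‖ψ C‖ ^ 2 := by
  rw [obsProb, h.obsResult_eq]

theorem IsObservation.obsProb_none {ψ χ : M.Space} (h : IsObservation ψ none χ) :
    obsProb ψ χ = ‖nonFinalPart ψ‖ ^ 2 := by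
  rw [obsProb, h.obsResult_eq]

/-- Each observation of `⊥` has as probability the ratio of successive squared norms of the branch,
and the product telescopes from `‖φ‖ = 1`. -/
theorem IsExit.seqProb_of_le (hM : M.IsQTM) (hφ : ‖φ‖ = 1) {h : ℕ} {C : M.Conf}
    (H : IsExit φ τ h C) {k : ℕ} (hk : k ≤ h) :
    seqProb τ k (fun i => path φ τ h C i) = ‖branch φ τ k‖ ^ 2 := by
  induction k with
  | zero => rw [seqProb, branch, hφ, one_pow]
  | succ k ih =>
    by_cases hkτ : k ∈ Set.range τ
    · have h0 : ‖branch φ τ k‖ ≠ 0 := norm_ne_zero_iff.2 (H.branch_ne_zero (Nat.le_of_lt hk))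
      rw [seqProb_succ_of_mem hkτ, ih (Nat.le_of_lt hk),
        (H.isObservation_of_lt hkτ hk).obsProb_none, path_of_le (Nat.le_of_lt hk),
        branch_succ_of_mem hkτ, nrm, map_smul, nonFinalPart_smul, norm_smul, Complex.norm_real,
        norm_inv, norm_norm]
      field_simp
    · rw [seqProb_succ_of_notMem hkτ, ih (Nat.le_of_lt hk), branch_succ_of_notMem hkτ, hM.norm_U]

/-- The exit contributes `‖U (branch h) C‖² / ‖branch h‖²`, which cancels the probability of
reaching time `h`; later observations contribute factors `1`. -/
theorem IsExit.seqProb_of_gt (hM : M.IsQTM) (hφ : ‖φ‖ = 1) {h : ℕ} {C : M.Conf}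
    (H : IsExit φ τ h C) {k : ℕ} (hk : h < k) :
    seqProb τ k (fun i => path φ τ h C i) = ‖M.U (branch φ τ h) C‖ ^ 2 := by
  induction k, hk using Nat.le_induction with
  | base =>
    have h0 : ‖branch φ τ h‖ ≠ 0 := norm_ne_zero_iff.2 (H.branch_ne_zero le_rfl)
    rw [Nat.succ_eq_add_one, seqProb_succ_of_mem H.mem, H.seqProb_of_le hM hφ le_rfl,
      H.isObservation_self.obsProb_some, path_of_le le_rfl, U_nrm_apply, norm_mul,
      Complex.norm_real, norm_inv, norm_norm]
    field_simp
  | succ k hk ih =>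
    by_cases hkτ : k ∈ Set.range τ
    · obtain ⟨D, -, h1, hD⟩ := H.isObservation_of_gt hM hk
      rw [seqProb_succ_of_mem hkτ, ih, hD.obsProb_some, h1, one_pow, mul_one]
    · rw [seqProb_succ_of_notMem hkτ, ih]

theorem IsExit.prob_run (hM : M.IsQTM) (hφ : ‖φ‖ = 1) {h : ℕ} {C : M.Conf}
    (H : IsExit φ τ h C) : (H.run hM hφ).prob = ‖M.U (branch φ τ h) C‖ ^ 2 := by
  refine Tendsto.limUnder_eq (tendsto_const_nhds.congr' ?_)
  filter_upwards [eventually_gt_atTop h] with k hk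
  exact (H.seqProb_of_gt hM hφ hk).symm

/-! ### Summation over exits -/

/-- The exits at the times in `T`, with output `n`. -/
def exits (φ : M.Space) (τ : ℕ → ℕ) (n : ℕ) (T : Set ℕ) : Set (ℕ × M.Conf) :=
  {x | x.1 ∈ T ∧ IsExit φ τ x.1 x.2 ∧ x.2.val = n}

theorem tsum_exits (φ : M.Space) (τ : ℕ → ℕ) (n : ℕ) (T : Set ℕ) :
    ∑' x : exits φ τ n T, ‖M.U (branch φ τ x.1.1) x.1.2‖ₑ ^ 2 =
      ∑' h, T.indicator (firstPpd φ τ n) h := by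
  classical
  rw [tsum_subtype (exits φ τ n T) fun x => ‖M.U (branch φ τ x.1) x.2‖ₑ ^ 2, ENNReal.tsum_prod']
  refine tsum_congr fun h => ?_
  by_cases hT : h ∈ T ∧ h ∈ Set.range τ
  · rw [Set.indicator_of_mem hT.1, firstPpd, if_pos hT.2, eppd]
    refine Eq.trans (tsum_congr fun C => ?_)
      (tsum_subtype {C : M.Conf | C.IsFinal ∧ C.val = n} fun C =>
        ‖M.U (branch φ τ h) C‖ₑ ^ 2).symm
    -- `firstPpd` also ranges over configurations of zero amplitude, which are not exits but add
    -- nothing to the sum.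
    by_cases h0 : M.U (branch φ τ h) C = 0
    · simp [Set.indicator_apply, h0]
    · refine Set.indicator_eq_indicator (?_ : _ ↔ _) rfl
      exact ⟨fun H => ⟨H.2.1.isFinal, H.2.2⟩, fun H => ⟨hT.1, ⟨hT.2, H.1, h0⟩, H.2⟩⟩
  · have h0 : T.indicator (firstPpd φ τ n) h = 0 := by
      by_cases h1 : h ∈ T
      · rw [Set.indicator_of_mem h1, firstPpd, if_neg fun h2 => hT ⟨h1, h2⟩]
      · exact Set.indicator_of_notMem h1 _
    rw [h0]
    refine ENNReal.tsum_eq_zero.2 fun C => Set.indicator_of_notMem ?_ _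
    exact fun H => hT ⟨H.1, H.2.1.mem⟩

theorem IsQTM.observedRun_Pr (hM : M.IsQTM) (hφ : ‖φ‖ = 1) {τ : ℕ → ℕ} (hτ : StrictMono τ) (n : ℕ) :
    ObservedRun.Pr {R : ObservedRun φ τ | R.HasOutput (some n)} =
      ENNReal.ofReal (computedOutput φ n) := by
  let e : exits φ τ n Set.univ → {R : ObservedRun φ τ | R.HasOutput (some n)} := fun x =>
    ⟨x.2.2.1.run hM hφ, by
      obtain ⟨i, hi⟩ := x.2.2.1.mem
      refine ⟨i, ?_⟩
      exact (x.2.2.1.obsValue_of_le hM hi.ge).trans (congrArg some x.2.2.2)⟩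
  have he : Function.Bijective e := by
    constructor
    · rintro ⟨⟨h, C⟩, hx⟩ ⟨⟨h', C'⟩, hx'⟩ heq
      have hp : path φ τ h C = path φ τ h' C' := congrArg (fun R => R.1.1) heq
      obtain ⟨rfl, rfl⟩ := path_injective hx.2.1 hx'.2.1
        (Nat.lt_succ_of_le (le_max_left h h')) (Nat.lt_succ_of_le (le_max_right h h'))
        (fun t _ => congrFun hp t)
      rfl
    · rintro ⟨R, i, hR⟩
      obtain ⟨h, -, C, HC, hv, hp⟩ := R.exists_eq_path hM hφ hR
      exact ⟨⟨(h, C), trivial, HC, hv⟩, Subtype.ext (Subtype.ext hp.symm)⟩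
  rw [ObservedRun.Pr, ← (Equiv.ofBijective e he).tsum_eq, ← hM.tsum_firstPpd φ hτ,
    ← Set.indicator_univ (firstPpd φ τ n), ← tsum_exits]
  refine tsum_congr fun x => ?_
  rw [← ofReal_norm_sq, ← x.2.2.1.prob_run hM hφ]
  rfl

theorem IsQTM.finiteRun_Pr (hM : M.IsQTM) (hφ : ‖φ‖ = 1) (τ : ℕ → ℕ) (n i : ℕ) :
    FiniteRun.Pr {r : FiniteRun φ τ (τ i + 1) | r.output = some n} =
      ENNReal.ofReal (ppd (comp φ (τ i + 1)) n) := by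
  let e : exits φ τ n (Set.Iio (τ i + 1)) →
      {r : FiniteRun φ τ (τ i + 1) | r.output = some n} := fun x =>
    ⟨⟨(x.2.2.1.run hM hφ).take (τ i + 1), _, rfl⟩,
      (x.2.2.1.obsValue_of_le hM (Nat.le_of_lt_succ x.2.1)).trans (congrArg some x.2.2.2)⟩
  have he : Function.Bijective e := by
    constructor
    · rintro ⟨⟨h, C⟩, hx⟩ ⟨⟨h', C'⟩, hx'⟩ heq
      have hp : ∀ t ≤ τ i + 1, path φ τ h C t = path φ τ h' C' t := fun t ht =>
        congrFun (congrArg (fun r => r.1.1) heq) (⟨t, Nat.lt_succ_of_le ht⟩ : Fin (τ i + 1 + 1))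
      obtain ⟨rfl, rfl⟩ := path_injective hx.2.1 hx'.2.1 hx.1 hx'.1 hp
      rfl
    · rintro ⟨⟨r, R, rfl⟩, hr⟩
      -- Any infinite run extending the prefix will do: the output at time `τ i` already forces an
      -- exit at or before that time.
      obtain ⟨h, hi, C, HC, hv, hp⟩ := R.exists_eq_path hM hφ (i := i) hr
      exact ⟨⟨(h, C), hi, HC, hv⟩,
        Subtype.ext (Subtype.ext (funext fun t => (congrFun hp t).symm))⟩
  rw [FiniteRun.Pr, ← (Equiv.ofBijective e he).tsum_eq, ofReal_ppd, hM.eppd_comp_observed,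
    ← Finset.tsum_subtype', Finset.coe_range, tsum_subtype, ← tsum_exits]
  refine tsum_congr fun x => ?_
  rw [← ofReal_norm_sq, ← x.2.2.1.seqProb_of_gt hM hφ x.2.1]
  rfl

end runs

end PreQTM

theorem mainTheorem2 {Q S : Type*} [Fintype Q] [Fintype S] [Inhabited S]
    (M : PreQTM Q S) (hM : M.IsQTM)
    (φ : M.Space) (hφ : PreQTM.IsInitialQConf φ)
    (τ : ℕ → ℕ) (hτ : StrictMono τ) (n : ℕ) :
    (∀ i : ℕ,
      PreQTM.FiniteRun.Pr {r : PreQTM.FiniteRun φ τ (τ i + 1) | r.output = some n} =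
        ENNReal.ofReal (PreQTM.ppd (PreQTM.comp φ (τ i + 1)) n)) ∧
    Tendsto (fun k : ℕ => PreQTM.ppd (PreQTM.comp φ k) n) atTop
      (𝓝 (PreQTM.computedOutput φ n)) ∧
    PreQTM.ObservedRun.Pr {R : PreQTM.ObservedRun φ τ | R.HasOutput (some n)} =
      ENNReal.ofReal (PreQTM.computedOutput φ n) :=
  ⟨fun i => hM.finiteRun_Pr hφ.1 τ n i, hM.tendsto_ppd_comp φ n, hM.observedRun_Pr hφ.1 hτ n⟩
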